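/- Let $G$ be a compact topological group acting continuously and transitively on a nonempty compact Hausdorff space $X$. Let $C(X)$ be the space of continuous functions $X\to\mathbb{C}$ with the uniform norm, and for $\alpha\in G$ put $\varphi_\alpha(x)=\alpha x$. A linear subspace $Y\subset C(X)$ is called $G$-invariant if $f\circ\varphi_\alpha\in Y$ for all $f\in Y$ and $\alpha\in G$; it is called $G$-minimal if it is nonzero and $G$-invariant and its only $G$-invariant linear subspaces are $\{0\}$ and $Y$. There is exactly one regular Borel probability measure $\mu$ on $X$ that is invariant under $G$. For this $\mu$ there is a collection $\mathscr{G}$ of $G$-minimal, finite-dimensional linear subspaces of $C(X)$ such that 1. each $H\in\mathscr{G}$ is closed in $C(X)$, and its image in $L^2(\mu)$ is closed; 2. any two distinct $H_1,H_2\in\mathscr{G}$ are orthogonal: $\int_X f_1\overline{f_2}\,d\mu=0$ for all $f_1\in H_1$ and $f_2\in H_2$; 3. $L^2(\mu)$ is the orthogonal (Hilbert space) direct sum of the images of the spaces $H\in\mathscr{G}$; that is, these images are pairwise orthogonal and their linear span is dense in $L^2(\mu)$. -/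

import Mathlib

/-- Composition `f ∘ φ_α` of a continuous function with the map `φ_α : x ↦ α • x`. -/
noncomputable def composeAction {G X : Type*} [TopologicalSpace X] [SMul G X] [ContinuousConstSMul G X]
    (α : G) (f : C(X, ℂ)) : C(X, ℂ) :=
  f.comp ⟨fun x => α • x, continuous_const_smul α⟩

/-- A space of continuous functions on `X` is `G`-invariant if it contains `f ∘ φ_α` for each of
its elements `f` and each `α` in `G`. -/
def IsGInvariant (G : Type*) {X : Type*} [TopologicalSpace X] [SMul G X] [ContinuousConstSMul G X]
    (Y : Submodule ℂ C(X, ℂ)) : Prop :=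
  ∀ f ∈ Y, ∀ α : G, composeAction α f ∈ Y

/-- A space of continuous functions on `X` is `G`-minimal if it is nonzero and `G`-invariant, and
its only `G`-invariant subspaces are zero and itself. -/
def IsGMinimal (G : Type*) {X : Type*} [TopologicalSpace X] [SMul G X] [ContinuousConstSMul G X]
    (Y : Submodule ℂ C(X, ℂ)) : Prop :=
  Y ≠ ⊥ ∧ IsGInvariant G Y ∧
    ∀ Z : Submodule ℂ C(X, ℂ), Z ≤ Y → IsGInvariant G Z → Z = ⊥ ∨ Z = Y

/-- Two spaces of continuous functions are orthogonal in `L²(μ)`. -/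
def AreOrthogonal {X : Type*} [TopologicalSpace X] [MeasurableSpace X]
    (μ : MeasureTheory.Measure X) (Y Z : Submodule ℂ C(X, ℂ)) : Prop :=
  ∀ f ∈ Y, ∀ g ∈ Z, ∫ x, f x * (starRingEnd ℂ) (g x) ∂μ = 0

/-- The image in `L²(μ)` of a space of continuous functions. -/
noncomputable def imageL2 {X : Type*} [TopologicalSpace X] [CompactSpace X] [MeasurableSpace X]
    [BorelSpace X] (μ : MeasureTheory.Measure X) [MeasureTheory.IsFiniteMeasure μ]
    (Y : Submodule ℂ C(X, ℂ)) : Submodule ℂ (MeasureTheory.Lp ℂ 2 μ) :=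
  Y.map (ContinuousMap.toLp (E := ℂ) 2 μ ℂ).toLinearMap

/-! Normalised Haar measure on `G`, pushed forward along an orbit map, is an invariant measure;
averaging over `G` and Fubini show it is the only regular one (`integral_eq_integral_orbit`).

For the decomposition, take by Zorn a maximal pairwise orthogonal family of finite-dimensional
minimal subspaces. Its span is dense for two reasons. Every finite-dimensional invariant `V` lies in
the algebraic sum of the family (`le_sSup_of_maximal`): only finitely many members fail to be
orthogonal to `V`, and removing the projections onto them leaves an invariant space orthogonal to
the whole family, which maximality forces to be zero. And such `V` are total in `L²(μ)`
(`eq_zero_of_forall_finiteDimensional_inner_eq_zero`): averaging a rank-one operator over `G` gives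
a compact symmetric operator commuting with `G`, whose eigenspaces for nonzero eigenvalues are
finite-dimensional, invariant and made of continuous functions. -/

open MeasureTheory Measure Module
open scoped InnerProductSpace ComplexConjugate

section HaarProbability

variable {G : Type*} [Group G] [TopologicalSpace G] [IsTopologicalGroup G] [CompactSpace G]
  [MeasurableSpace G] [BorelSpace G]

/-- Right translations commute with left ones, so a right translate is again a Haar probability
measure, and there is only one. -/
theorem isMulRightInvariant_of_isHaarMeasure_of_compactSpace (m : Measure G)
    [IsProbabilityMeasure m] [m.IsHaarMeasure] : m.IsMulRightInvariant where
  map_mul_right_eq_self g := by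
    have : IsProbabilityMeasure (m.map (· * g)) :=
      isProbabilityMeasure_map (measurable_mul_const g).aemeasurable
    exact isHaarMeasure_eq_of_isProbabilityMeasure _ _

variable (G) in
theorem exists_regular_haar_probabilityMeasure :
    ∃ m : Measure G, IsProbabilityMeasure m ∧ m.Regular ∧ m.IsHaarMeasure := by
  refine ⟨haarMeasure ⊤, ⟨?_⟩, inferInstance, inferInstance⟩
  have := haarMeasure_self (K₀ := (⊤ : TopologicalSpace.PositiveCompacts G))
  simpa using this

end HaarProbability

/-! ### The invariant probability measure on `X` -/

section InvariantMeasure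

variable {G X : Type*} [Group G] [TopologicalSpace G] [TopologicalSpace X]
  [MeasurableSpace X] [BorelSpace X] [MulAction G X] [ContinuousSMul G X]
  [MeasurableSpace G] [BorelSpace G]

theorem regular_map_orbit [CompactSpace G] [T2Space X] (m : Measure G) [IsProbabilityMeasure m] [m.Regular] (x₀ : X) :
    (m.map fun α : G => α • x₀).Regular := by
  have hc : Continuous fun α : G => α • x₀ := by fun_prop
  have : IsProbabilityMeasure (m.map fun α : G => α • x₀) :=
    isProbabilityMeasure_map hc.aemeasurable
  have : (m.map fun α : G => α • x₀).InnerRegular := InnerRegular.map_of_continuous hc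
  infer_instance

theorem smulInvariantMeasure_map_orbit [IsTopologicalGroup G] (m : Measure G) [m.IsMulLeftInvariant] (x₀ : X) :
    SMulInvariantMeasure G X (m.map fun α : G => α • x₀) where
  measure_preimage_smul β s hs := by
    have hc : Measurable fun α : G => α • x₀ :=
      (show Continuous fun α : G => α • x₀ by fun_prop).measurable
    have hβ : Measurable fun x : X => β • x := (continuous_const_smul β).measurable
    rw [map_apply hc (hβ hs), map_apply hc hs,
      ← measure_preimage_mul m β ((fun α : G => α • x₀) ⁻¹' s)]
    simp only [Set.preimage_preimage, mul_smul]

/-- By transitivity and right invariance, the average of `f` over `G` along an orbit does not depend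
on the base point; integrating that average against `μ` and swapping gives the formula. -/
theorem integral_eq_integral_orbit [IsTopologicalGroup G] [CompactSpace G] [CompactSpace X]
    [MulAction.IsPretransitive G X] (m : Measure G)
    [IsProbabilityMeasure m] [m.IsMulRightInvariant] (x₀ : X) (μ : Measure X)
    [IsProbabilityMeasure μ] [SMulInvariantMeasure G X μ] (f : C(X, ℝ)) :
    ∫ x, f x ∂μ = ∫ α, f (α • x₀) ∂m := by
  have hinv (α : G) : ∫ x, f (α • x) ∂μ = ∫ x, f x ∂μ :=
    integral_smul_eq_self (μ := μ) f
  have horb (x : X) : ∫ α : G, f (α • x) ∂m = ∫ α, f (α • x₀) ∂m := by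
    obtain ⟨β, rfl⟩ := MulAction.exists_smul_eq G x₀ x
    simp_rw [smul_smul]
    exact integral_mul_right_eq_self (μ := m) (fun α => f (α • x₀)) β
  calc ∫ x, f x ∂μ = ∫ _ : G, ∫ x, f x ∂μ ∂m := by simp
    _ = ∫ α : G, ∫ x, f (α • x) ∂μ ∂m := by simp_rw [hinv]
    _ = ∫ x, ∫ α : G, f (α • x) ∂m ∂μ := by
        -- Without second countability `f (α • x)` need not be measurable for the product σ-algebra,
        -- hence the Fubini theorem for continuous functions of compact support.
        refine integral_integral_swap_of_hasCompactSupport ?_ (HasCompactSupport.of_compactSpace _)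
        exact f.continuous.comp continuous_smul
    _ = ∫ α, f (α • x₀) ∂m := by simp [horb]

end InvariantMeasure

theorem existsUnique_regular_smulInvariant_probabilityMeasure {G X : Type*}
    [Group G] [TopologicalSpace G] [IsTopologicalGroup G] [CompactSpace G]
    [TopologicalSpace X] [CompactSpace X] [T2Space X] [Nonempty X]
    [MeasurableSpace X] [BorelSpace X]
    [MulAction G X] [ContinuousSMul G X] [MulAction.IsPretransitive G X] :
    ∃! μ : Measure X, IsProbabilityMeasure μ ∧ μ.Regular ∧ SMulInvariantMeasure G X μ := by
  borelize G
  obtain ⟨m, _, _, _⟩ := exists_regular_haar_probabilityMeasure G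
  have := isMulRightInvariant_of_isHaarMeasure_of_compactSpace m
  obtain ⟨x₀⟩ := ‹Nonempty X›
  have hc : Continuous fun α : G => α • x₀ := by fun_prop
  refine ⟨m.map fun α : G => α • x₀, ⟨isProbabilityMeasure_map hc.aemeasurable,
    regular_map_orbit m x₀, smulInvariantMeasure_map_orbit m x₀⟩, ?_⟩
  rintro ν ⟨_, _, _⟩
  have := regular_map_orbit m x₀
  refine Measure.ext_of_integral_eq_on_compactlySupported fun f => ?_
  have h := integral_eq_integral_orbit m x₀ ν f.toContinuousMap
  rwa [← integral_map (φ := fun α : G => α • x₀) hc.aemeasurable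
    f.toContinuousMap.continuous.aestronglyMeasurable] at h

theorem Continuous.integrable_of_compactSpace {Y E : Type*} [TopologicalSpace Y] [CompactSpace Y]
    [MeasurableSpace Y] [BorelSpace Y] [NormedAddCommGroup E] {f : Y → E} (hf : Continuous f)
    (m : Measure Y) [IsFiniteMeasure m] : Integrable f m :=
  hf.integrable_of_hasCompactSupport (HasCompactSupport.of_compactSpace f)

/-! ### Translations of continuous functions -/

section ComposeAction

variable {G X : Type*} [Group G] [TopologicalSpace X] [MulAction G X]

@[simp]
theorem composeAction_apply [ContinuousConstSMul G X] (α : G) (f : C(X, ℂ)) (x : X) :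
    composeAction α f x = f (α • x) := rfl

/-- Composition with the action of `α`, as a linear map. -/
noncomputable def composeActionLinear [ContinuousConstSMul G X] (α : G) :
    C(X, ℂ) →ₗ[ℂ] C(X, ℂ) where
  toFun := composeAction α
  map_add' _ _ := rfl
  map_smul' _ _ := rfl

@[simp]
theorem composeActionLinear_apply [ContinuousConstSMul G X] (α : G) (f : C(X, ℂ)) :
    composeActionLinear α f = composeAction α f := rfl

theorem composeAction_composeAction [ContinuousConstSMul G X] (α β : G) (f : C(X, ℂ)) :
    composeAction β (composeAction α f) = composeAction (α * β) f := by
  ext x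
  simp [mul_smul]

@[simp]
theorem composeAction_one [ContinuousConstSMul G X] (f : C(X, ℂ)) :
    composeAction (1 : G) f = f := by
  ext x
  simp

theorem continuous_composeAction [TopologicalSpace G] [ContinuousSMul G X] (f : C(X, ℂ)) :
    Continuous fun α : G => composeAction α f :=
  ContinuousMap.continuous_of_continuous_uncurry _ (f.continuous.comp continuous_smul)

theorem exists_isGMinimal_le [ContinuousConstSMul G X] {V : Submodule ℂ C(X, ℂ)}
    [FiniteDimensional ℂ V] (hV : IsGInvariant G V) (hV0 : V ≠ ⊥) :
    ∃ M ≤ V, IsGMinimal G M := by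
  obtain ⟨M, ⟨hMV, hM0, hM⟩, hmin⟩ := exists_minimalFor_of_wellFoundedLT
    (fun M : Submodule ℂ C(X, ℂ) => M ≤ V ∧ M ≠ ⊥ ∧ IsGInvariant G M)
    (fun M => finrank ℂ M) ⟨V, le_rfl, hV0, hV⟩
  refine ⟨M, hMV, hM0, hM, fun Z hZM hZ => or_iff_not_imp_left.2 fun hZ0 => ?_⟩
  have : FiniteDimensional ℂ M := Submodule.finiteDimensional_of_le hMV
  exact Submodule.eq_of_le_of_finrank_le hZM
    (hmin ⟨hZM.trans hMV, hZ0, hZ⟩ (Submodule.finrank_mono hZM))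

end ComposeAction

/-- The image of `H` is finite-dimensional, so the orthogonal projection onto it exists and pulls
back along `J`. It serves to project `C(X)` onto `H` for the `L²` inner product while staying among
continuous functions. -/
theorem exists_orthogonalProjection_of_injective {E F : Type*} [AddCommGroup E] [Module ℂ E]
    [NormedAddCommGroup F] [InnerProductSpace ℂ F] {J : E →ₗ[ℂ] F} (hJ : Function.Injective J)
    (H : Submodule ℂ E) [FiniteDimensional ℂ H] :
    ∃ P : E →ₗ[ℂ] E, (∀ f, P f ∈ H) ∧ ∀ f, ∀ h ∈ H, ⟪J h, J (f - P f)⟫_ℂ = 0 := by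
  obtain ⟨L, hL⟩ := J.exists_leftInverse_of_injective (LinearMap.ker_eq_bot.2 hJ)
  have hL' (f : E) : L (J f) = f := LinearMap.congr_fun hL f
  have hmem (f : E) : ∃ p ∈ H, J p = (H.map J).starProjection (J f) :=
    (H.map J).starProjection_apply_mem (J f)
  refine ⟨L ∘ₗ (H.map J).starProjection.toLinearMap ∘ₗ J, fun f => ?_, fun f h hh => ?_⟩
  · obtain ⟨p, hp, hpf⟩ := hmem f
    simpa [← hpf, hL'] using hp
  · obtain ⟨p, hp, hpf⟩ := hmem f
    have : J (f - L ((H.map J).starProjection (J f))) = J f - (H.map J).starProjection (J f) := by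
      rw [map_sub, ← hpf, hL']
    simp only [LinearMap.comp_apply, ContinuousLinearMap.coe_coe, this]
    exact Submodule.inner_right_of_mem_orthogonal (Submodule.mem_map_of_mem hh)
      ((H.map J).sub_starProjection_mem_orthogonal (J f))

theorem Continuous.rankOne {E F Y : Type*} [NormedAddCommGroup E] [NormedSpace ℂ E]
    [NormedAddCommGroup F] [InnerProductSpace ℂ F] [TopologicalSpace Y] {f : Y → E} {g : Y → F}
    (hf : Continuous f) (hg : Continuous g) :
    Continuous fun y => InnerProductSpace.rankOne ℂ (f y) (g y) := by
  simp only [InnerProductSpace.rankOne_def]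
  fun_prop

theorem isCompactOperator_rankOne {E F : Type*} [NormedAddCommGroup E] [NormedSpace ℂ E]
    [NormedAddCommGroup F] [InnerProductSpace ℂ F] (x : E) (y : F) :
    IsCompactOperator (InnerProductSpace.rankOne ℂ x y) := by
  have hid : IsCompactOperator (id : ℂ → ℂ) :=
    isCompactOperator_id_iff_locallyCompactSpace.2 inferInstance
  exact (hid.comp_clm (innerSL ℂ y)).clm_comp (ContinuousLinearMap.toSpanSingleton ℂ x)

/-- Compact operators form a closed convex set, which contains the mean of any integrable family of
its elements. -/
theorem IsCompactOperator.integral {E F Ω : Type*} [NormedAddCommGroup E] [NormedSpace ℂ E]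
    [NormedAddCommGroup F] [NormedSpace ℂ F] [CompleteSpace F] [MeasurableSpace Ω] {m : Measure Ω}
    [IsProbabilityMeasure m] {T : Ω → E →L[ℂ] F} (hT : Integrable T m)
    (hc : ∀ ω, IsCompactOperator (T ω)) : IsCompactOperator (∫ ω, T ω ∂m : E →L[ℂ] F) := by
  have hconv : Convex ℝ {T : E →L[ℂ] F | IsCompactOperator T} :=
    ((compactOperator (RingHom.id ℂ) E F).restrictScalars ℝ).convex
  exact hconv.integral_mem isClosed_setOfPred_isCompactOperator (.of_forall hc) hT

section L2

variable {G X : Type*} [Group G]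
  [TopologicalSpace X] [CompactSpace X] [MeasurableSpace X] [BorelSpace X] [MulAction G X]

/-- The inner product of `L²(μ)` on continuous functions. -/
local notation "⟪" f "," g "⟫[" μ "]" => (inner ℂ (ContinuousMap.toLp (E := ℂ) 2 μ ℂ f) (ContinuousMap.toLp (E := ℂ) 2 μ ℂ g))

theorem areOrthogonal_iff_inner {μ : Measure X} [IsFiniteMeasure μ]
    {Y Z : Submodule ℂ C(X, ℂ)} :
    AreOrthogonal μ Y Z ↔ ∀ f ∈ Y, ∀ g ∈ Z, ⟪g, f⟫[μ] = 0 := by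
  simp only [AreOrthogonal, ContinuousMap.inner_toLp]

theorem AreOrthogonal.symm {μ : Measure X} [IsFiniteMeasure μ]
    {Y Z : Submodule ℂ C(X, ℂ)} (h : AreOrthogonal μ Y Z) : AreOrthogonal μ Z Y := by
  rw [areOrthogonal_iff_inner] at h ⊢
  exact fun f hf g hg => inner_eq_zero_symm.1 (h g hg f hf)

/-! ### Orthogonal families of invariant subspaces -/

section Invariant

variable [ContinuousConstSMul G X] (μ : Measure X) [IsFiniteMeasure μ] [SMulInvariantMeasure G X μ]

theorem inner_toLp_composeAction (α : G) (f g : C(X, ℂ)) :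
    ⟪composeAction α f, composeAction α g⟫[μ] = ⟪f, g⟫[μ] := by
  simp only [ContinuousMap.inner_toLp, composeAction_apply]
  exact integral_smul_eq_self (μ := μ) (fun x => g x * conj (f x))

theorem inner_toLp_composeAction_left (α : G) (f g : C(X, ℂ)) :
    ⟪composeAction α f, g⟫[μ] = ⟪f, composeAction α⁻¹ g⟫[μ] := by
  rw [← inner_toLp_composeAction μ α f, composeAction_composeAction]
  simp

variable {μ} [μ.IsOpenPosMeasure]

/-- The difference of the two sides lies in `H` and is orthogonal to `H`; since `μ` charges nonempty
open sets, it is zero. -/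
theorem orthogonalProjection_composeAction {H : Submodule ℂ C(X, ℂ)} (hH : IsGInvariant G H)
    {P : C(X, ℂ) →ₗ[ℂ] C(X, ℂ)} (hPH : ∀ f, P f ∈ H)
    (hP : ∀ f, ∀ h ∈ H, ⟪h, f - P f⟫[μ] = 0) (α : G) (f : C(X, ℂ)) :
    P (composeAction α f) = composeAction α (P f) := by
  have hd : composeAction α (P f) - P (composeAction α f) ∈ H :=
    H.sub_mem (hH _ (hPH f) α) (hPH _)
  set d := composeAction α (P f) - P (composeAction α f) with hddef
  have h1 := hP (composeAction α f) d hd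
  have h2 : ⟪d, composeAction α (f - P f)⟫[μ] = 0 := by
    rw [← inv_inv α, ← inner_toLp_composeAction_left]
    exact hP f _ (hH _ hd _)
  have h3 : ⟪d, d⟫[μ] = 0 := by
    have : d = (composeAction α f - P (composeAction α f)) - composeAction α (f - P f) := by
      rw [← composeActionLinear_apply α (f - P f), map_sub]
      simp [hddef]
    calc ⟪d, d⟫[μ] = ⟪d, (composeAction α f - P (composeAction α f)) - composeAction α (f - P f)⟫[μ] :=
          by rw [← this]
      _ = 0 := by rw [map_sub _ (composeAction α f - _), inner_sub_right, h1, h2, sub_zero]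
  have h4 : d = 0 := by
    apply ContinuousMap.toLp_injective (E := ℂ) (p := 2) (𝕜 := ℂ) μ
    simpa using h3
  exact (sub_eq_zero.1 h4).symm

variable [MulAction.IsPretransitive G X] [Nonempty X]

/-- The functionals `v ↦ (P_H v)(x₀)` on `V` are linearly independent, so there are at most `dim V`
of them. A relation at `x₀`, applied to all translates of `v`, holds at every point; pairing it with
an element of one `H` isolates one coefficient. -/
theorem finite_setOf_not_areOrthogonal {𝒢 : Set (Submodule ℂ C(X, ℂ))}
    (hinv : ∀ H ∈ 𝒢, IsGInvariant G H) (hfin : ∀ H ∈ 𝒢, FiniteDimensional ℂ H)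
    (horth : 𝒢.Pairwise (AreOrthogonal μ)) {V : Submodule ℂ C(X, ℂ)} [FiniteDimensional ℂ V]
    (hV : IsGInvariant G V) : {H ∈ 𝒢 | ¬ AreOrthogonal μ V H}.Finite := by
  have hex (H : {H ∈ 𝒢 | ¬ AreOrthogonal μ V H}) : ∃ P : C(X, ℂ) →ₗ[ℂ] C(X, ℂ),
      (∀ f, P f ∈ H.1) ∧ ∀ f, ∀ h ∈ H.1, ⟪h, f - P f⟫[μ] = 0 := by
    have := hfin H.1 H.2.1
    exact exists_orthogonalProjection_of_injective
      (J := (ContinuousMap.toLp (E := ℂ) 2 μ ℂ).toLinearMap) (ContinuousMap.toLp_injective μ) H.1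
  choose P hPmem hP using hex
  obtain ⟨x₀⟩ := ‹Nonempty X›
  let ℓ (H : {H ∈ 𝒢 | ¬ AreOrthogonal μ V H}) : Dual ℂ V :=
    (ContinuousMap.evalCLM ℂ x₀).toLinearMap ∘ₗ P H ∘ₗ V.subtype
  suffices LinearIndependent ℂ ℓ from @Set.toFinite _ _ this.finite
  rw [linearIndependent_iff']
  intro s c hc i hi
  have hi' := i.2.2
  rw [areOrthogonal_iff_inner] at hi'
  push Not at hi'
  obtain ⟨v, hv, h, hh, hne⟩ := hi'
  have hsum : ∑ j ∈ s, c j • P j v = 0 := by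
    ext x
    obtain ⟨α, rfl⟩ := MulAction.exists_smul_eq G x₀ x
    have hcomm (j) : P j (composeAction α v) = composeAction α (P j v) :=
      orthogonalProjection_composeAction (hinv _ j.2.1) (hPmem j) (hP j) α v
    have := LinearMap.congr_fun hc ⟨composeAction α v, hV v hv α⟩
    simpa [ℓ, hcomm] using this
  have hzero : ∑ j ∈ s, c j * ⟪h, P j v⟫[μ] = 0 := by
    have := congrArg (fun f => ⟪h, f⟫[μ]) hsum
    simpa [inner_sum, inner_smul_right] using this
  rw [Finset.sum_eq_single i] at hzero
  -- Since `h` lies in the `i`-th space, pairing it with `P i v` is the same as pairing it with `v`,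
  -- which is nonzero by choice.
  · refine (mul_eq_zero.1 hzero).resolve_right fun h0 => hne ?_
    have := hP i v h hh
    rwa [map_sub, inner_sub_right, h0, sub_zero] at this
  · intro j _ hji
    have := areOrthogonal_iff_inner.1
      (horth j.2.1 i.2.1 fun e => hji (Subtype.ext e)) (P j v) (hPmem j v) h hh
    rw [this, mul_zero]
  · exact fun h' => absurd hi h'

theorem le_sSup_of_maximal {𝒢 : Set (Submodule ℂ C(X, ℂ))}
    (hmax : Maximal (fun 𝒢 : Set (Submodule ℂ C(X, ℂ)) =>
      (∀ H ∈ 𝒢, IsGMinimal G H ∧ FiniteDimensional ℂ H) ∧ 𝒢.Pairwise (AreOrthogonal μ)) 𝒢)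
    {V : Submodule ℂ C(X, ℂ)} [FiniteDimensional ℂ V] (hV : IsGInvariant G V) : V ≤ sSup 𝒢 := by
  obtain ⟨⟨h𝒢, horth⟩, hmax⟩ := hmax
  have hfin := finite_setOf_not_areOrthogonal (fun H hH => (h𝒢 H hH).1.2.1)
    (fun H hH => (h𝒢 H hH).2) horth hV
  have hex (H : Submodule ℂ C(X, ℂ)) : ∃ P : C(X, ℂ) →ₗ[ℂ] C(X, ℂ), H ∈ 𝒢 →
      (∀ f, P f ∈ H) ∧ ∀ f, ∀ h ∈ H, ⟪h, f - P f⟫[μ] = 0 := by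
    by_cases hH : H ∈ 𝒢
    · have := (h𝒢 H hH).2
      obtain ⟨P, hP⟩ := exists_orthogonalProjection_of_injective
        (J := (ContinuousMap.toLp (E := ℂ) 2 μ ℂ).toLinearMap) (ContinuousMap.toLp_injective μ) H
      exact ⟨P, fun _ => hP⟩
    · exact ⟨0, fun h => absurd h hH⟩
  choose P hP using hex
  -- A finite sum, so no question of convergence in `C(X)` arises; on `V` the omitted projections
  -- vanish.
  let Q : C(X, ℂ) →ₗ[ℂ] C(X, ℂ) := ∑ H ∈ hfin.toFinset, P H
  have hQ (f : C(X, ℂ)) : Q f = ∑ H ∈ hfin.toFinset, P H f := by simp [Q]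
  have hmem {H} (hH : H ∈ hfin.toFinset) : H ∈ 𝒢 := (hfin.mem_toFinset.1 hH).1
  have hQinv (α : G) (f : C(X, ℂ)) : Q (composeAction α f) = composeAction α (Q f) := by
    rw [hQ, hQ, ← composeActionLinear_apply α (∑ _ ∈ _, _), _root_.map_sum]
    refine Finset.sum_congr rfl fun H hH => ?_
    exact orthogonalProjection_composeAction (h𝒢 H (hmem hH)).1.2.1
      (hP H (hmem hH)).1 (hP H (hmem hH)).2 α f
  have hort {H} (hH : H ∈ 𝒢) {h} (hh : h ∈ H) {v} (hv : v ∈ V) : ⟪h, v - Q v⟫[μ] = 0 := by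
    rw [map_sub, inner_sub_right, hQ, _root_.map_sum, inner_sum]
    have hother {K} (hK : K ∈ hfin.toFinset) (hKH : K ≠ H) : ⟪h, P K v⟫[μ] = 0 :=
      areOrthogonal_iff_inner.1 (horth (hmem hK) hH hKH) _ ((hP K (hmem hK)).1 v) h hh
    by_cases hHs : H ∈ hfin.toFinset
    · rw [Finset.sum_eq_single_of_mem H hHs fun K hK hKH => hother hK hKH,
        ← inner_sub_right, ← map_sub]
      exact (hP H hH).2 v h hh
    · rw [Finset.sum_eq_zero fun K hK => hother hK fun e => hHs (e ▸ hK), sub_zero]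
      have : AreOrthogonal μ V H := by
        by_contra hc
        exact hHs (hfin.mem_toFinset.2 ⟨hH, hc⟩)
      exact areOrthogonal_iff_inner.1 this v hv h hh
  let V' := V.map (LinearMap.id - Q)
  have hV' : IsGInvariant G V' := by
    rintro _ ⟨v, hv, rfl⟩ α
    refine ⟨composeAction α v, hV v hv α, ?_⟩
    simp only [LinearMap.sub_apply, LinearMap.id_apply, hQinv]
    rw [← composeActionLinear_apply, ← composeActionLinear_apply, ← map_sub]
    rfl
  have hV'orth {H} (hH : H ∈ 𝒢) : AreOrthogonal μ V' H := by
    rw [areOrthogonal_iff_inner]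
    rintro _ ⟨v, hv, rfl⟩ h hh
    exact hort hH hh hv
  have hbot : V' = ⊥ := by
    by_contra hne
    obtain ⟨M, hMV, hM⟩ := exists_isGMinimal_le hV' hne
    have hMorth {H} (hH : H ∈ 𝒢) : AreOrthogonal μ M H :=
      fun f hf g hg => hV'orth hH f (hMV hf) g hg
    -- Maximality puts `M` in the family, making it orthogonal to itself and hence zero.
    have hMmem : M ∈ 𝒢 := by
      refine hmax (y := insert M 𝒢) ⟨?_, ?_⟩ (Set.subset_insert _ _) (Set.mem_insert _ _)
      · rintro H (rfl | hH)
        · exact ⟨hM, Submodule.finiteDimensional_of_le hMV⟩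
        · exact h𝒢 H hH
      · exact horth.insert fun H hH _ => ⟨hMorth hH, (hMorth hH).symm⟩
    refine hM.1 ((Submodule.eq_bot_iff _).2 fun f hf => ?_)
    have := areOrthogonal_iff_inner.1 (hMorth hMmem) f hf f hf
    apply ContinuousMap.toLp_injective (E := ℂ) (p := 2) (𝕜 := ℂ) μ
    simpa using this
  intro v hv
  have hvQ : v - Q v = 0 := by
    have : v - Q v ∈ V' := ⟨v, hv, rfl⟩
    rwa [hbot, Submodule.mem_bot] at this
  rw [sub_eq_zero.1 hvQ, hQ]
  exact Submodule.sum_mem _ fun H hH => le_sSup (hmem hH) ((hP H (hmem hH)).1 v)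

end Invariant

theorem continuous_rankOne_composeAction [TopologicalSpace G] [ContinuousSMul G X]
    (μ : Measure X) [IsFiniteMeasure μ] (h : C(X, ℂ)) :
    Continuous fun α : G => InnerProductSpace.rankOne ℂ (composeAction α h)
      (ContinuousMap.toLp (E := ℂ) 2 μ ℂ (composeAction α h)) := by
  have hc := continuous_composeAction (G := G) h
  exact hc.rankOne ((ContinuousMap.toLp (E := ℂ) 2 μ ℂ).continuous.comp' hc)

/-! ### Averaged rank-one operators and their eigenspaces -/

section Averaging

variable [TopologicalSpace G] [CompactSpace G] [MeasurableSpace G] [BorelSpace G]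
  [ContinuousSMul G X] (m : Measure G) [IsProbabilityMeasure m]
  (μ : Measure X) [IsFiniteMeasure μ] (h : C(X, ℂ))

/-- The operator `g ↦ ∫ ⟪h ∘ φ_α, g⟫ • (h ∘ φ_α) dα` from `L²(μ)` to `C(X)`. -/
noncomputable def averageRankOne : Lp ℂ 2 μ →L[ℂ] C(X, ℂ) :=
  ∫ α : G, InnerProductSpace.rankOne ℂ (composeAction α h)
    (ContinuousMap.toLp (E := ℂ) 2 μ ℂ (composeAction α h)) ∂m

theorem averageRankOne_apply (g : Lp ℂ 2 μ) :
    averageRankOne m μ h g =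
      ∫ α : G, ⟪ContinuousMap.toLp (E := ℂ) 2 μ ℂ (composeAction α h), g⟫_ℂ •
        composeAction α h ∂m :=
  ContinuousLinearMap.integral_apply
    ((continuous_rankOne_composeAction μ h).integrable_of_compactSpace m) g

theorem isCompactOperator_averageRankOne : IsCompactOperator (averageRankOne m μ h) := by
  have hint := (continuous_rankOne_composeAction (G := G) μ h).integrable_of_compactSpace m
  have hc (α : G) := isCompactOperator_rankOne (composeAction α h)
    (ContinuousMap.toLp (E := ℂ) 2 μ ℂ (composeAction α h))
  unfold averageRankOne
  exact IsCompactOperator.integral hint hc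

theorem inner_averageRankOne (f g : Lp ℂ 2 μ) :
    ⟪f, ContinuousMap.toLp (E := ℂ) 2 μ ℂ (averageRankOne m μ h g)⟫_ℂ =
      ∫ α : G, ⟪ContinuousMap.toLp (E := ℂ) 2 μ ℂ (composeAction α h), g⟫_ℂ *
        ⟪f, ContinuousMap.toLp (E := ℂ) 2 μ ℂ (composeAction α h)⟫_ℂ ∂m := by
  have hc := continuous_composeAction (G := G) h
  rw [averageRankOne_apply, ← ContinuousLinearMap.integral_comp_comm, ← integral_inner]
  · simp [inner_smul_right]
  · exact Continuous.integrable_of_compactSpace (by fun_prop) m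
  · exact Continuous.integrable_of_compactSpace (by fun_prop) m

theorem isSymmetric_averageRankOne :
    (((ContinuousMap.toLp (E := ℂ) 2 μ ℂ) ∘L averageRankOne m μ h :
      Lp ℂ 2 μ →L[ℂ] Lp ℂ 2 μ) : Lp ℂ 2 μ →ₗ[ℂ] Lp ℂ 2 μ).IsSymmetric := by
  intro f g
  simp only [ContinuousLinearMap.coe_coe, ContinuousLinearMap.comp_apply]
  rw [← inner_conj_symm, inner_averageRankOne, inner_averageRankOne, ← integral_conj]
  simp [mul_comm]

/-- Pairing the average with `g` gives the integral of `|⟪h ∘ φ_α, g⟫|²`. This continuous function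
of `α` then vanishes everywhere, in particular at `α = 1`. -/
theorem inner_eq_zero_of_averageRankOne_eq_zero [m.IsOpenPosMeasure] {g : Lp ℂ 2 μ}
    (hg : averageRankOne m μ h g = 0) : ⟪ContinuousMap.toLp (E := ℂ) 2 μ ℂ h, g⟫_ℂ = 0 := by
  have hc := continuous_composeAction (G := G) h
  have h1 := inner_averageRankOne m μ h g g
  let F (α : G) : ℝ := ‖⟪ContinuousMap.toLp (E := ℂ) 2 μ ℂ (composeAction α h), g⟫_ℂ‖ ^ 2
  have hF : Continuous F := by fun_prop
  have h2 : ∫ α, F α ∂m = 0 := by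
    rw [hg] at h1
    simp only [map_zero, inner_zero_right] at h1
    rw [← Complex.ofReal_inj, ← integral_complex_ofReal, Complex.ofReal_zero, h1]
    refine integral_congr_ae (.of_forall fun α => ?_)
    simp only [F]
    rw [← inner_conj_symm g, Complex.mul_conj, Complex.normSq_eq_norm_sq]
  rw [integral_eq_zero_iff_of_nonneg (fun α => by positivity)
    (hF.integrable_of_compactSpace m)] at h2
  have h3 : F = 0 := (hF.ae_eq_iff_eq m continuous_const).1 h2
  simpa [F] using congrFun h3 1

/-- Substitute `α * β` for `α` and use the invariance of the inner product. -/
theorem averageRankOne_composeAction [IsTopologicalGroup G] [m.IsMulRightInvariant]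
    [SMulInvariantMeasure G X μ] (β : G) (f : C(X, ℂ)) :
    averageRankOne m μ h (ContinuousMap.toLp (E := ℂ) 2 μ ℂ (composeAction β f)) =
      composeAction β (averageRankOne m μ h (ContinuousMap.toLp (E := ℂ) 2 μ ℂ f)) := by
  have hc := continuous_composeAction (G := G) h
  ext x
  rw [composeAction_apply, averageRankOne_apply, averageRankOne_apply,
    ContinuousMap.integral_apply, ContinuousMap.integral_apply]
  · rw [← integral_mul_right_eq_self (μ := m) _ β]
    refine integral_congr_ae (.of_forall fun α => ?_)
    simp only [← composeAction_composeAction, inner_toLp_composeAction]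
    simp
  · exact Continuous.integrable_of_compactSpace (by fun_prop) m
  · exact Continuous.integrable_of_compactSpace (by fun_prop) m

/-- For each `h`, `T g` is orthogonal to every eigenspace of the averaged operator `T`, so the
spectral theorem gives `T g = 0` and then `g` is orthogonal to `h`. Continuous functions are dense
in `L²(μ)`. -/
theorem eq_zero_of_forall_finiteDimensional_inner_eq_zero [IsTopologicalGroup G]
    [m.IsMulRightInvariant] [m.IsOpenPosMeasure] [T2Space X] [μ.Regular]
    [SMulInvariantMeasure G X μ] [μ.IsOpenPosMeasure] {g : Lp ℂ 2 μ}
    (hg : ∀ V : Submodule ℂ C(X, ℂ), FiniteDimensional ℂ V → IsGInvariant G V →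
      ∀ v ∈ V, ⟪ContinuousMap.toLp (E := ℂ) 2 μ ℂ v, g⟫_ℂ = 0) : g = 0 := by
  have key (h : C(X, ℂ)) : ⟪ContinuousMap.toLp (E := ℂ) 2 μ ℂ h, g⟫_ℂ = 0 := by
    let J := ContinuousMap.toLp (α := X) (E := ℂ) 2 μ ℂ
    let S := averageRankOne m μ h
    let T : Lp ℂ 2 μ →L[ℂ] Lp ℂ 2 μ := J ∘L S
    have hJ : Function.Injective J := ContinuousMap.toLp_injective μ
    have hT : IsCompactOperator T := (isCompactOperator_averageRankOne m μ h).clm_comp J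
    have hTs : T.IsSymmetric := isSymmetric_averageRankOne m μ h
    have hTg : T g ∈ (⨆ c, End.eigenspace (T : End ℂ (Lp ℂ 2 μ)) c)ᗮ := by
      rw [Submodule.mem_orthogonal]
      intro u hu
      induction hu using Submodule.iSup_induction' with
      | zero => simp
      | add x y _ _ hx hy => rw [inner_add_left, hx, hy, add_zero]
      | mem c e he =>
        have hTe : T e = c • e := End.mem_eigenspace_iff.1 he
        have hsymm : ⟪e, T g⟫_ℂ = ⟪T e, g⟫_ℂ := (hTs e g).symm
        rw [hsymm]
        by_cases hc : c = 0
        · simp [hTe, hc]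
        -- The eigenspace is taken inside `C(X)`, where invariance makes sense; `J` embeds it in
        -- that of `T`, finite-dimensional because `c ≠ 0`.
        let V : Submodule ℂ C(X, ℂ) := End.eigenspace (S.toLinearMap ∘ₗ J.toLinearMap) c
        have hVmem (v : C(X, ℂ)) : v ∈ V ↔ S (J v) = c • v := End.mem_eigenspace_iff
        have hVfin : FiniteDimensional ℂ V := by
          have := ContinuousLinearMap.finite_dimensional_eigenspace hT c hc
          have hmaps : ∀ v ∈ V, J v ∈ End.eigenspace T.toLinearMap c := by
            intro v hv
            rw [End.mem_eigenspace_iff]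
            simp [T, (hVmem v).1 hv]
          refine FiniteDimensional.of_injective (J.toLinearMap.restrict hmaps) ?_
          exact fun v w hvw => Subtype.ext (hJ (congrArg Subtype.val hvw))
        have hVinv : IsGInvariant G V := by
          intro v hv β
          rw [hVmem] at hv ⊢
          rw [averageRankOne_composeAction m μ h β v]
          rw [show averageRankOne m μ h (J v) = c • v from hv]
          rfl
        have hJS : J (S e) = c • e := hTe
        have hSe : S e ∈ V := by
          rw [hVmem, hJS, map_smul]
        have := hg V hVfin hVinv (S e) hSe
        exact this
    rw [ContinuousLinearMap.orthogonalComplement_iSup_eigenspaces_eq_bot hT hTs,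
      Submodule.mem_bot] at hTg
    refine inner_eq_zero_of_averageRankOne_eq_zero m μ h (hJ ?_)
    rw [map_zero]
    exact hTg
  have hd := ContinuousMap.toLp_denseRange (α := X) ℂ μ ℂ (p := 2) (by simp)
  exact hd.eq_zero_of_inner_right ℂ key

end Averaging

/-! ### The Hilbert sum decomposition -/

theorem exists_isHilbertSum_isGMinimal [TopologicalSpace G] [IsTopologicalGroup G] [CompactSpace G]
    [T2Space X] [Nonempty X] [ContinuousSMul G X] [MulAction.IsPretransitive G X]
    (μ : Measure X) [IsProbabilityMeasure μ] [μ.Regular] [SMulInvariantMeasure G X μ] :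
    ∃ 𝒢 : Set (Submodule ℂ C(X, ℂ)),
      (∀ H ∈ 𝒢, IsGMinimal G H ∧ FiniteDimensional ℂ H ∧ IsClosed (H : Set C(X, ℂ)) ∧
        IsClosed (imageL2 μ H : Set (Lp ℂ 2 μ))) ∧
      𝒢.Pairwise (AreOrthogonal μ) ∧
      IsHilbertSum ℂ (fun H : 𝒢 => imageL2 μ H.1) (fun H : 𝒢 => (imageL2 μ H.1).subtypeₗᵢ) := by
  borelize G
  obtain ⟨m, _, _, _⟩ := exists_regular_haar_probabilityMeasure G
  have := isMulRightInvariant_of_isHaarMeasure_of_compactSpace m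
  -- By transitivity and compactness, finitely many translates of a nonempty open set cover `X`, so
  -- it is not null.
  have : μ.IsOpenPosMeasure := ⟨fun U hU hne =>
    (measure_isOpen_pos_of_smulInvariant_of_ne_zero G (IsProbabilityMeasure.ne_zero μ) hU hne).ne'⟩
  obtain ⟨𝒢, hmax⟩ := zorn_subset {𝒢 : Set (Submodule ℂ C(X, ℂ)) |
      (∀ H ∈ 𝒢, IsGMinimal G H ∧ FiniteDimensional ℂ H) ∧ 𝒢.Pairwise (AreOrthogonal μ)} <| by
    intro c hc hchain
    refine ⟨⋃₀ c, ⟨?_, ?_⟩, fun s => Set.subset_sUnion_of_mem⟩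
    · rintro H ⟨s, hs, hH⟩
      exact (hc hs).1 H hH
    · exact (Set.pairwise_sUnion hchain.directedOn).2 fun s hs => (hc hs).2
  have hfd (H : 𝒢) : FiniteDimensional ℂ (imageL2 μ H.1) := by
    have := (hmax.prop.1 H.1 H.2).2
    unfold imageL2
    infer_instance
  refine ⟨𝒢, fun H hH => ?_, hmax.prop.2, ?_⟩
  · obtain ⟨hmin, hfin⟩ := hmax.prop.1 H hH
    have := hfd ⟨H, hH⟩
    exact ⟨hmin, hfin, H.closed_of_finiteDimensional,
      (imageL2 μ H).closed_of_finiteDimensional⟩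
  · have (H : 𝒢) : CompleteSpace (imageL2 μ H.1) := FiniteDimensional.complete ℂ _
    refine IsHilbertSum.mkInternal _ ?_ ?_
    · rintro H K hHK ⟨_, f, hf, rfl⟩ ⟨_, g, hg, rfl⟩
      exact areOrthogonal_iff_inner.1
        (hmax.prop.2 K.2 H.2 fun e => hHK (Subtype.ext e.symm)) g hg f hf
    · rw [top_le_iff, Submodule.topologicalClosure_eq_top_iff, Submodule.eq_bot_iff]
      intro g hg
      refine eq_zero_of_forall_finiteDimensional_inner_eq_zero (G := G) m μ
        fun V hVfin hV v hv => ?_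
      refine hg _ ?_
      have hv' := le_sSup_of_maximal hmax hV hv
      have := Submodule.mem_map_of_mem
        (f := (ContinuousMap.toLp (α := X) (E := ℂ) 2 μ ℂ).toLinearMap) hv'
      rw [sSup_eq_iSup', Submodule.map_iSup] at this
      exact this

end L2

theorem theorem4p1 {G X : Type*}
    [Group G] [TopologicalSpace G] [IsTopologicalGroup G] [CompactSpace G]
    [TopologicalSpace X] [CompactSpace X] [T2Space X] [Nonempty X]
    [MeasurableSpace X] [BorelSpace X]
    [MulAction G X] [ContinuousSMul G X] [MulAction.IsPretransitive G X] :
    (∃! μ : MeasureTheory.Measure X, MeasureTheory.IsProbabilityMeasure μ ∧ μ.Regular ∧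
      MeasureTheory.SMulInvariantMeasure G X μ) ∧
    ∀ (μ : MeasureTheory.Measure X) [MeasureTheory.IsProbabilityMeasure μ] [μ.Regular]
      [MeasureTheory.SMulInvariantMeasure G X μ],
      ∃ 𝒢 : Set (Submodule ℂ C(X, ℂ)),
        (∀ H ∈ 𝒢, IsGMinimal G H ∧ FiniteDimensional ℂ H ∧
          IsClosed (H : Set C(X, ℂ)) ∧
          IsClosed (imageL2 μ H : Set (MeasureTheory.Lp ℂ 2 μ))) ∧
        𝒢.Pairwise (AreOrthogonal μ) ∧
        IsHilbertSum ℂ (fun H : 𝒢 => imageL2 μ H.1) (fun H : 𝒢 => (imageL2 μ H.1).subtypeₗᵢ) :=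
  ⟨existsUnique_regular_smulInvariant_probabilityMeasure,
    fun μ _ _ _ => exists_isHilbertSum_isGMinimal μ⟩
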